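/- Consider an AC power network with a slack bus $0$ and PQ-buses $1,\dots,n$. Write $i\sim k$ if the buses $i$ and $k$ are joined by a line; each line has an admittance $y_{ik}=y_{ki}\in\mathbb{C}\setminus\{0\}$. The full solvability set $F\subset\mathbb{R}^{2n}$ is the set of all $(P_1,\dots,P_n,Q_1,\dots,Q_n)\in\mathbb{R}^{2n}$ for which there are voltages $V_1,\dots,V_n\in\mathbb{C}$ such that, with $V_0=1$, $$P_i+\mathrm{j}\,Q_i=V_i\sum_{k\sim i}y_{ik}^*\,(V_i-V_k)^*\qquad\text{for } i=1,\dots,n,$$ where $\mathrm{j}$ is the imaginary unit and ${}^*$ is complex conjugation. Suppose that the graph of lines on the buses $0,1,\dots,n$ is connected and acyclic (a tree), and that the network is homogeneous: all the line admittances $y_{ik}$, $i\sim k$, have the same argument. Then $F$ is convex. -/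

import Mathlib

/-- An AC power network with buses `0, 1, …, n`. Bus `0` is the slack bus and the buses `1, …, n`,
that is `Fin.succ i` for `i : Fin n`, are the PQ-buses. `graph.Adj i k` says that the buses `i` and
`k` are connected by a line; `y i k` is then the (non-zero) admittance of that line. The value of
`y i k` is irrelevant when there is no line between `i` and `k`. -/
structure PowerNetwork (n : ℕ) where
  /-- The graph of lines. -/
  graph : SimpleGraph (Fin (n + 1))
  /-- The line admittances. -/
  y : Fin (n + 1) → Fin (n + 1) → ℂ
  y_symm : ∀ i k, graph.Adj i k → y i k = y k i
  y_ne_zero : ∀ i k, graph.Adj i k → y i k ≠ 0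

namespace PowerNetwork

/-- The complex power `S_i = V_i ∑_{k ∼ i} y_{ik}^* (V_i - V_k)^*` injected at bus `i` when the bus
voltages are `V`. -/
noncomputable def powerInjection {n : ℕ} (N : PowerNetwork n) (V : Fin (n + 1) → ℂ)
    (i : Fin (n + 1)) : ℂ :=
  open Classical in
  V i * ∑ k with N.graph.Adj i k,
    (starRingEnd ℂ) (N.y i k) * (starRingEnd ℂ) (V i - V k)

/-- The full solvability set `F ⊆ ℝ^{2n}`: all vectors `p = (P_1, …, P_n, Q_1, …, Q_n)` for which
the power flow equations at the PQ-buses, `S_i = P_i + j Q_i` for `i = 1, …, n`, have a solution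
`V` with slack voltage `V_0 = 1`. -/
def solvabilitySet {n : ℕ} (N : PowerNetwork n) : Set (Fin (n + n) → ℝ) :=
  {p | ∃ V : Fin (n + 1) → ℂ, V 0 = 1 ∧ ∀ i : Fin n,
    (p (Fin.castAdd n i) : ℂ) + (p (Fin.natAdd n i) : ℂ) * Complex.I =
      N.powerInjection V i.succ}

/-- A network is homogeneous if all its line admittances have the same argument. -/
def IsHomogeneous {n : ℕ} (N : PowerNetwork n) : Prop :=
  ∃ φ : ℝ, ∀ i k, N.graph.Adj i k → (N.y i k).arg = φ

end PowerNetwork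

open Finset

/-! Multiplying by the common phase of the admittances makes every line weight real and positive.
The equations then become linear in `x i = |V i|²` and `W i k = V i * conj (V k)`, and a convex
combination of two solutions satisfies them with only `|W i k|² ≤ x i * x k`. Equality is restored
by keeping the imaginary parts `s` of `W`, replacing the real parts by `√(x i * x k - s i k ^ 2)`
and raising `x`. The averaged data form a subsolution of the resulting monotone system, and an
energy bound makes the supremum of all subsolutions above it finite, hence a solution. Acyclicity
lets the arguments of `W` integrate to voltage angles. -/

/-- On a tree, every antisymmetric function on the edges is the difference of a vertex potential. -/
theorem SimpleGraph.IsTree.exists_potential {ι A : Type*} [AddCommGroup A] {G : SimpleGraph ι}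
    (hG : G.IsTree) (r : ι) (d : ι → ι → A) (hd : ∀ i k, G.Adj i k → d k i = -d i k) :
    ∃ θ : ι → A, θ r = 0 ∧ ∀ i k, G.Adj i k → θ i - θ k = d i k := by
  let θ : ∀ {u v : ι}, G.Walk u v → A := fun p ↦ (p.darts.map fun e ↦ d e.snd e.fst).sum
  have hconcat : ∀ {u v w : ι} (p : G.Walk u v) (h : G.Adj v w), θ (p.concat h) = θ p + d w v := by
    intro u v w p h
    simp [θ, SimpleGraph.Walk.darts_concat]
  choose p hp hp' using fun v ↦ hG.existsUnique_path r v
  refine ⟨fun v ↦ θ (p v), ?_, ?_⟩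
  · change θ (p r) = 0
    rw [← hp' r .nil .nil]
    simp [θ]
  intro i k h
  -- In a tree, one of the paths from `r` to `i` and `k` extends the other by the edge between them.
  by_cases hk : k ∈ (p i).support
  · have e := hG.isAcyclic.path_concat (hp k) (hp i) h.symm hk
    have := hconcat (p k) h.symm
    rw [← e] at this
    simp [this]
  · have hi := hG.isAcyclic.mem_support_of_ne_mem_support_of_adj_of_isPath (hp k) (hp i)
      h.symm hk
    have e := hG.isAcyclic.path_concat (hp i) (hp k) h hi
    have := hconcat (p i) h
    rw [← e] at this
    simp [this, hd i k h]

section Laplacian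

variable {ι : Type*} [Fintype ι] {g : ι → ι → ℝ}

theorem sum_sum_mul_mul_sub_eq (hsymm : ∀ i k, g i k = g k i) (v : ι → ℝ) :
    ∑ i, ∑ k, g i k * (v i - v k) ^ 2 = 2 * ∑ i, ∑ k, g i k * (v i * (v i - v k)) := by
  have h : ∑ i, ∑ k, g i k * (v i * (v i - v k)) = ∑ i, ∑ k, g i k * (v k * (v k - v i)) := by
    rw [sum_comm]
    simp_rw [hsymm]
  rw [two_mul]
  nth_rewrite 2 [h]
  simp_rw [← sum_add_distrib]
  exact sum_congr rfl fun i _ ↦ sum_congr rfl fun k _ ↦ by ring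

/-- Vertex functions with bounded Dirichlet energy on a connected graph, normalised at one vertex,
are bounded at every vertex. -/
theorem exists_bound_of_energy_le {G : SimpleGraph ι} (hG : G.Connected)
    (hnonneg : ∀ i k, 0 ≤ g i k) (hpos : ∀ i k, G.Adj i k → 0 < g i k) (r : ι) (b K : ℝ) (i : ι) :
    ∃ B : ℝ, ∀ v : ι → ℝ, v r = b → ∑ i, ∑ k, g i k * (v i - v k) ^ 2 ≤ K → v i ≤ B := by
  obtain ⟨p⟩ := hG.preconnected i r
  induction p with
  | nil => exact ⟨b, fun v hv _ ↦ hv.le⟩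
  | @cons u w _ h _ ih =>
    obtain ⟨B, hB⟩ := ih
    refine ⟨B + √(K / g u w), fun v hv hK ↦ ?_⟩
    have h1 : g u w * (v u - v w) ^ 2 ≤ K := by
      have hn : ∀ i k, 0 ≤ g i k * (v i - v k) ^ 2 := fun i k ↦
        mul_nonneg (hnonneg i k) (sq_nonneg _)
      exact ((single_le_sum (fun k _ ↦ hn u k) (mem_univ w)).trans
        (single_le_sum (f := fun i ↦ ∑ k, g i k * (v i - v k) ^ 2)
          (fun i _ ↦ sum_nonneg fun k _ ↦ hn i k) (mem_univ u))).trans hK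
    have h2 : v u - v w ≤ √(K / g u w) := by
      refine (le_abs_self _).trans (Real.abs_le_sqrt ?_)
      rwa [le_div_iff₀ (hpos u w h), mul_comm]
    linarith [hB v hv hK]

/-- A subsolution of the power balance equations lies below a solution. -/
theorem exists_power_balance_of_subsolution {G : SimpleGraph ι} (hG : G.Connected)
    (hsymm : ∀ i k, g i k = g k i) (hnonneg : ∀ i k, 0 ≤ g i k)
    (hpos : ∀ i k, G.Adj i k → 0 < g i k) (r : ι) (s : ι → ι → ℝ) (P x₀ : ι → ℝ)
    (hx₀ : 0 ≤ x₀) (hr : x₀ r = 1)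
    (hsub : ∀ i, i ≠ r → ∑ k, g i k * (x₀ i - √(x₀ i * x₀ k - s i k ^ 2)) ≤ P i) :
    ∃ x, x₀ ≤ x ∧ x r = 1 ∧
      ∀ i, i ≠ r → ∑ k, g i k * (x i - √(x i * x k - s i k ^ 2)) = P i := by
  classical
  have hdeg : ∀ i, i ≠ r → 0 < ∑ k, g i k := by
    intro i hi
    have : Nontrivial ι := ⟨i, r, hi⟩
    obtain ⟨k, hk⟩ := SimpleGraph.Preconnected.exists_adj_of_nontrivial hG.preconnected i
    exact sum_pos' (fun k _ ↦ hnonneg i k) ⟨k, mem_univ k, hpos i k hk⟩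
  -- The balance at `i` solved for the linear occurrence of `x i`: subsolutions satisfy `x ≤ T x`,
  -- solutions are fixed points. `T` is monotone on `0 ≤ x`, even where a radicand is negative,
  -- since `√` is then `0`.
  let T : (ι → ℝ) → ι → ℝ := fun x i ↦
    if i = r then 1 else (P i + ∑ k, g i k * √(x i * x k - s i k ^ 2)) / ∑ k, g i k
  have hTr : ∀ x, T x r = 1 := fun x ↦ by simp [T]
  have hle : ∀ x i, i ≠ r →
      (x i ≤ T x i ↔ ∑ k, g i k * (x i - √(x i * x k - s i k ^ 2)) ≤ P i) := by
    intro x i hi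
    simp only [T, if_neg hi, mul_sub, sum_sub_distrib, ← sum_mul]
    rw [le_div_iff₀ (hdeg i hi), mul_comm, sub_le_iff_le_add]
  have hge : ∀ x i, i ≠ r →
      (T x i ≤ x i ↔ P i ≤ ∑ k, g i k * (x i - √(x i * x k - s i k ^ 2))) := by
    intro x i hi
    simp only [T, if_neg hi, mul_sub, sum_sub_distrib, ← sum_mul]
    rw [div_le_iff₀ (hdeg i hi), mul_comm (x i), le_sub_iff_add_le]
  have hmono : ∀ x y, 0 ≤ x → x ≤ y → T x ≤ T y := by
    intro x y hx hxy i
    by_cases hi : i = r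
    · simp [T, hi]
    simp only [T, if_neg hi]
    have h0 := hdeg i hi
    gcongr with k
    · exact hnonneg i k
    · exact hx k
    · exact (hx i).trans (hxy i)
    · exact hxy i
    · exact hxy k
  let A : Set (ι → ℝ) := {x | x₀ ≤ x ∧ x ≤ T x}
  have hA : x₀ ∈ A := by
    refine ⟨le_rfl, fun i ↦ ?_⟩
    by_cases hi : i = r
    · subst hi; rw [hTr, hr]
    · exact (hle x₀ i hi).2 (hsub i hi)
  have hAr : ∀ x ∈ A, x r = 1 := fun x hx ↦
    le_antisymm ((hx.2 r).trans (hTr x).le) (hr.symm.le.trans (hx.1 r))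
  have hbdd : BddAbove A := by
    -- Bounds the energy of `√x`: since `√(x i * x k - s i k ^ 2) ≤ √(x i) * √(x k)`, bus `i ≠ r`
    -- contributes at most `P i`; at `r`, `1 - √(x k) ≤ 1`.
    let K : ℝ := 2 * ∑ i, if i = r then ∑ k, g r k else P i
    choose B hB using exists_bound_of_energy_le hG hnonneg hpos r 1 K
    refine ⟨fun i ↦ B i ^ 2, fun x hx i ↦ ?_⟩
    have hx0 : 0 ≤ x := hx₀.trans hx.1
    refine (Real.sqrt_le_iff.1 (hB i (fun i ↦ √(x i)) ?_ ?_)).2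
    · simp [hAr x hx]
    · rw [sum_sum_mul_mul_sub_eq hsymm]
      refine mul_le_mul_of_nonneg_left (sum_le_sum fun i _ ↦ ?_) zero_le_two
      split_ifs with hi
      · subst hi
        rw [hAr x hx]
        refine sum_le_sum fun k _ ↦ mul_le_of_le_one_right (hnonneg i k) ?_
        simp
      · refine le_trans (sum_le_sum fun k _ ↦ mul_le_mul_of_nonneg_left ?_ (hnonneg i k))
          ((hle x i hi).1 (hx.2 i))
        rw [mul_sub, Real.mul_self_sqrt (hx0 i), ← Real.sqrt_mul (hx0 i)]
        gcongr
        linarith [sq_nonneg (s i k)]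
  -- Knaster–Tarski: the supremum of the post-fixed points is a fixed point.
  have hxA : x₀ ≤ sSup A := le_csSup hbdd hA
  have hsup : sSup A ≤ T (sSup A) := csSup_le ⟨x₀, hA⟩ fun x hx ↦
    hx.2.trans (hmono x _ (hx₀.trans hx.1) (le_csSup hbdd hx))
  have hsup' : T (sSup A) ≤ sSup A := le_csSup hbdd
    ⟨hxA.trans hsup, hmono _ _ (hx₀.trans hxA) hsup⟩
  exact ⟨sSup A, hxA, hAr _ ⟨hxA, hsup⟩, fun i hi ↦
    le_antisymm ((hle _ i hi).1 (hsup i)) ((hge _ i hi).1 (hsup' i))⟩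

end Laplacian

/-- On a tree, a Hermitian edge function `c + j s` with `c ≥ 0` and `c² + s² = x_i x_k` comes from
a voltage vector with squared magnitudes `x`. -/
theorem SimpleGraph.IsTree.exists_voltage {ι : Type*} {G : SimpleGraph ι} (hG : G.IsTree) (r : ι)
    (x : ι → ℝ) (hx : 0 ≤ x) (hr : x r = 1) (s : ι → ι → ℝ) (hs : ∀ i k, s k i = -s i k)
    (hsx : ∀ i k, s i k ^ 2 ≤ x i * x k) :
    ∃ V : ι → ℂ, V r = 1 ∧ (∀ i, V i * (starRingEnd ℂ) (V i) = x i) ∧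
      ∀ i k, G.Adj i k →
        V i * (starRingEnd ℂ) (V k) = ⟨√(x i * x k - s i k ^ 2), s i k⟩ := by
  let W : ι → ι → ℂ := fun i k ↦ ⟨√(x i * x k - s i k ^ 2), s i k⟩
  have hnorm : ∀ i k, ‖W i k‖ = √(x i) * √(x k) := by
    intro i k
    rw [← Real.sqrt_mul (hx i), Complex.norm_eq_sqrt_sq_add_sq]
    congr 1
    simp only [W]
    rw [Real.sq_sqrt (sub_nonneg.2 (hsx i k))]
    ring
  have hconj : ∀ i k, W k i = (starRingEnd ℂ) (W i k) := by
    intro i k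
    apply Complex.ext <;> simp [W, hs i k, mul_comm (x k)]
  -- Conjugation negates the argument unless it is `π`, which the nonnegative real part of `W i k`
  -- excludes.
  obtain ⟨θ, hθr, hθ⟩ := hG.exists_potential r (fun i k ↦ (W i k).arg) (by
    intro i k _
    rw [hconj, Complex.arg_conj, if_neg]
    intro h
    exact absurd (Complex.arg_eq_pi_iff.1 h).1 (not_lt.2 (Real.sqrt_nonneg _)))
  have hmul : ∀ i k, (√(x i) * Complex.exp (θ i * Complex.I)) *
      (starRingEnd ℂ) (√(x k) * Complex.exp (θ k * Complex.I)) =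
      (√(x i) * √(x k) : ℝ) * Complex.exp ((θ i - θ k : ℝ) * Complex.I) := by
    intro i k
    have : ((θ i - θ k : ℝ) : ℂ) * Complex.I = θ i * Complex.I + -(θ k * Complex.I) := by
      push_cast; ring
    rw [this, Complex.exp_add, map_mul, ← Complex.exp_conj]
    simp
    ring
  refine ⟨fun i ↦ √(x i) * Complex.exp (θ i * Complex.I), by simp [hr, hθr], fun i ↦ ?_,
    fun i k h ↦ ?_⟩
  · rw [hmul, Real.mul_self_sqrt (hx i)]
    simp
  · rw [hmul, hθ i k h, ← hnorm, Complex.norm_mul_exp_arg_mul_I]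

namespace PowerNetwork

variable {n : ℕ} (N : PowerNetwork n)

open Classical in
/-- The magnitudes of the line admittances, `0` where there is no line. -/
noncomputable def weight (i k : Fin (n + 1)) : ℝ :=
  if N.graph.Adj i k then ‖N.y i k‖ else 0

theorem weight_comm (i k : Fin (n + 1)) : N.weight i k = N.weight k i := by
  unfold weight
  by_cases h : N.graph.Adj i k
  · rw [if_pos h, if_pos h.symm, N.y_symm i k h]
  · rw [if_neg h, if_neg fun h' ↦ h h'.symm]

theorem weight_nonneg (i k : Fin (n + 1)) : 0 ≤ N.weight i k := by
  unfold weight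
  split_ifs
  · exact norm_nonneg _
  · exact le_rfl

theorem weight_pos (i k : Fin (n + 1)) (h : N.graph.Adj i k) : 0 < N.weight i k := by
  rw [weight, if_pos h]
  exact norm_pos_iff.2 (N.y_ne_zero i k h)

theorem exp_mul_powerInjection {φ : ℝ} (hφ : ∀ i k, N.graph.Adj i k → (N.y i k).arg = φ)
    (V : Fin (n + 1) → ℂ) (i : Fin (n + 1)) :
    Complex.exp (φ * Complex.I) * N.powerInjection V i =
      ∑ k, (N.weight i k : ℂ) *
        (V i * (starRingEnd ℂ) (V i) - V i * (starRingEnd ℂ) (V k)) := by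
  unfold powerInjection weight
  rw [mul_sum, mul_sum, sum_filter]
  refine sum_congr rfl fun k _ ↦ ?_
  split_ifs with h
  · have hy : Complex.exp (φ * Complex.I) * (starRingEnd ℂ) (N.y i k) = ‖N.y i k‖ := by
      conv_lhs => rw [← Complex.norm_mul_exp_arg_mul_I (N.y i k), hφ i k h]
      rw [map_mul, ← Complex.exp_conj, mul_left_comm, ← Complex.exp_add]
      simp
    rw [← hy, map_sub]
    ring
  · simp

end PowerNetwork

/-- Cauchy–Schwarz in Lagrange form: the two sides differ by `a * b * |z₁ * w₂ - z₂ * w₁|²`. -/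
theorem sq_add_sq_le_of_convex_combination (z₁ z₂ w₁ w₂ : ℂ) {a b : ℝ} (ha : 0 ≤ a) (hb : 0 ≤ b) :
    (a * (z₁ * (starRingEnd ℂ) w₁) + b * (z₂ * (starRingEnd ℂ) w₂)).re ^ 2 +
      (a * (z₁ * (starRingEnd ℂ) w₁) + b * (z₂ * (starRingEnd ℂ) w₂)).im ^ 2 ≤
      (a * Complex.normSq z₁ + b * Complex.normSq z₂) *
        (a * Complex.normSq w₁ + b * Complex.normSq w₂) := by
  have h := mul_nonneg (mul_nonneg ha hb) (Complex.normSq_nonneg (z₁ * w₂ - z₂ * w₁))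
  simp only [Complex.normSq_apply, Complex.add_re, Complex.add_im, Complex.mul_re, Complex.mul_im,
    Complex.sub_re, Complex.sub_im, Complex.conj_re, Complex.conj_im, Complex.ofReal_re,
    Complex.ofReal_im] at h ⊢
  linarith

theorem theorem1 {n : ℕ} (N : PowerNetwork n) (hconn : N.graph.Connected)
    (hacyc : N.graph.IsAcyclic) (hhom : N.IsHomogeneous) :
    Convex ℝ N.solvabilitySet := by
  obtain ⟨φ, hφ⟩ := hhom
  rintro p ⟨V₁, hV₁, hp⟩ q ⟨V₂, hV₂, hq⟩ a b ha hb hab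
  let x₀ : Fin (n + 1) → ℝ := fun i ↦ a * Complex.normSq (V₁ i) + b * Complex.normSq (V₂ i)
  let W : Fin (n + 1) → Fin (n + 1) → ℂ := fun i k ↦
    a * (V₁ i * (starRingEnd ℂ) (V₁ k)) + b * (V₂ i * (starRingEnd ℂ) (V₂ k))
  let s : Fin (n + 1) → Fin (n + 1) → ℝ := fun i k ↦ (W i k).im
  have hW : ∀ i k, (W i k).re ^ 2 + s i k ^ 2 ≤ x₀ i * x₀ k := fun i k ↦
    sq_add_sq_le_of_convex_combination _ _ _ _ ha hb
  have hx₀ : 0 ≤ x₀ := fun i ↦ add_nonneg (mul_nonneg ha (Complex.normSq_nonneg _))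
    (mul_nonneg hb (Complex.normSq_nonneg _))
  obtain ⟨x, hx₀x, hxr, hx⟩ := exists_power_balance_of_subsolution hconn N.weight_comm
    N.weight_nonneg N.weight_pos 0 s (fun i ↦ ∑ k, N.weight i k * (x₀ i - (W i k).re)) x₀ hx₀
    (by simp [x₀, hV₁, hV₂, hab]) (by
      intro i _
      refine sum_le_sum fun k _ ↦ mul_le_mul_of_nonneg_left ?_ (N.weight_nonneg i k)
      refine sub_le_sub_left ((le_abs_self _).trans (Real.abs_le_sqrt ?_)) _
      linarith [hW i k])
  have hxn : 0 ≤ x := hx₀.trans hx₀x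
  obtain ⟨V, hVr, hVx, hVs⟩ := SimpleGraph.IsTree.exists_voltage ⟨hconn, hacyc⟩ 0 x hxn hxr s
    (by intro i k; simp [s, W]; ring) (by
      intro i k
      have := mul_le_mul (hx₀x i) (hx₀x k) (hx₀ k) (hxn i)
      nlinarith [hW i k, sq_nonneg (W i k).re])
  refine ⟨V, hVr, fun i ↦ ?_⟩
  have hcomb : (((a • p + b • q) (Fin.castAdd n i) : ℝ) : ℂ) +
      (((a • p + b • q) (Fin.natAdd n i) : ℝ) : ℂ) * Complex.I =
      a * N.powerInjection V₁ i.succ + b * N.powerInjection V₂ i.succ := by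
    rw [← hp i, ← hq i]
    simp
    ring
  rw [hcomb]
  -- After rotation, the real part is the balance solved by `x`, and the imaginary part depends only
  -- on `s`, which is unchanged.
  apply mul_left_cancel₀ (Complex.exp_ne_zero (φ * Complex.I))
  rw [mul_add, mul_left_comm, mul_left_comm _ (b : ℂ), N.exp_mul_powerInjection hφ,
    N.exp_mul_powerInjection hφ, N.exp_mul_powerInjection hφ]
  have hleft : (a : ℂ) * (∑ k, (N.weight i.succ k : ℂ) * (V₁ i.succ * (starRingEnd ℂ) (V₁ i.succ) -
        V₁ i.succ * (starRingEnd ℂ) (V₁ k))) +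
      b * (∑ k, (N.weight i.succ k : ℂ) * (V₂ i.succ * (starRingEnd ℂ) (V₂ i.succ) -
        V₂ i.succ * (starRingEnd ℂ) (V₂ k))) =
      ∑ k, (N.weight i.succ k : ℂ) * ((x₀ i.succ : ℂ) - W i.succ k) := by
    rw [mul_sum, mul_sum, ← sum_add_distrib]
    refine sum_congr rfl fun k _ ↦ ?_
    simp only [x₀, W, Complex.mul_conj]
    push_cast
    ring
  have hright : ∑ k, (N.weight i.succ k : ℂ) * (V i.succ * (starRingEnd ℂ) (V i.succ) -
        V i.succ * (starRingEnd ℂ) (V k)) =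
      ∑ k, (N.weight i.succ k : ℂ) *
        ((x i.succ : ℂ) - ⟨√(x i.succ * x k - s i.succ k ^ 2), s i.succ k⟩) := by
    refine sum_congr rfl fun k _ ↦ ?_
    by_cases h : N.graph.Adj i.succ k
    · rw [hVx, hVs _ _ h]
    · simp [PowerNetwork.weight, h]
  rw [hleft, hright]
  apply Complex.ext
  · simpa using (hx i.succ (Fin.succ_ne_zero i)).symm
  · simp [s]
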